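/- All graphs are finite, simple and undirected. For a graph $G$ and $S\subseteq V(G)$ let $\omega(G-S)$ be the number of connected components of $G-S$. For a real number $t$, $G$ is $t$-tough if $|S|\ge t\cdot\omega(G-S)$ for every $S\subseteq V(G)$ with $\omega(G-S)>1$; the toughness $\tau(G)$ is the largest $t$ for which $G$ is $t$-tough, with $\tau(G)=\infty$ if $G$ is complete. $G$ is minimally $t$-tough if $\tau(G)=t$ and $\tau(G-e)<t$ for every edge $e$ of $G$. An interval graph is the intersection graph of a family of intervals of the real line. A hole in a graph is an induced cycle of length at least $4$. Three distinct, pairwise nonadjacent vertices form an asteroidal triple if every two of them are connected by a path containing no neighbor of the third. Corollary. (1) For every rational number $t>1/2$, there is no minimally $t$-tough interval graph. (2) Equivalently, for every rational number $t>1$, every minimally $t$-tough graph contains a hole or an asteroidal triple. -/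

import Mathlib

namespace SimpleGraph

/-- The number of connected components of `G - S`. -/
noncomputable def numComponentsDelete {V : Type*} (G : SimpleGraph V) (S : Set V) : ℕ :=
  Nat.card (G.induce Sᶜ).ConnectedComponent

/-- `G` is `t`-tough: `|S| ≥ t · ω(G - S)` for every vertex set `S` with `ω(G - S) > 1`. -/
def IsTough {V : Type*} (G : SimpleGraph V) (t : ℝ) : Prop :=
  ∀ S : Set V, 1 < G.numComponentsDelete S → t * (G.numComponentsDelete S : ℝ) ≤ (S.ncard : ℝ)

/-- The toughness of `G`: the largest real `t` for which `G` is `t`-tough, and `⊤` if `G` is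
complete. The lemmas `isGreatest_toughness` and `toughness_top` show that, for finite graphs, the
supremum below is exactly this. -/
noncomputable def toughness {V : Type*} (G : SimpleGraph V) : EReal :=
  sSup ((fun t : ℝ => (t : EReal)) '' {t : ℝ | G.IsTough t})

/-- `G` is minimally `t`-tough: its toughness is `t`, and deleting any edge decreases it. -/
def IsMinimallyTough {V : Type*} (G : SimpleGraph V) (t : EReal) : Prop :=
  G.toughness = t ∧ ∀ e ∈ G.edgeSet, (G.deleteEdges {e}).toughness < t

/-- `G` is an interval graph: the intersection graph of a family of (nonempty, closed, bounded)
intervals of the real line. -/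
def IsIntervalGraph {V : Type*} (G : SimpleGraph V) : Prop :=
  ∃ l r : V → ℝ, (∀ v, l v ≤ r v) ∧
    ∀ u v, G.Adj u v ↔ u ≠ v ∧ (Set.Icc (l u) (r u) ∩ Set.Icc (l v) (r v)).Nonempty

/-- `G` contains a hole: an induced cycle of length at least 4. -/
def HasHole {V : Type*} (G : SimpleGraph V) : Prop :=
  ∃ n : ℕ, 4 ≤ n ∧ Nonempty (cycleGraph n ↪g G)

/-- Some path of `G` from `x` to `y` avoids the neighborhood of `z`. -/
def HasPathAvoidingNeighborhood {V : Type*} (G : SimpleGraph V) (x y z : V) : Prop :=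
  ∃ p : G.Walk x y, p.IsPath ∧ ∀ w ∈ p.support, w ∉ G.neighborSet z

/-- `x, y, z` form an asteroidal triple: they are distinct and pairwise nonadjacent, and every two
of them are connected by a path avoiding the neighborhood of the third. -/
def IsAsteroidalTriple {V : Type*} (G : SimpleGraph V) (x y z : V) : Prop :=
  (x ≠ y ∧ y ≠ z ∧ x ≠ z) ∧ (¬ G.Adj x y ∧ ¬ G.Adj y z ∧ ¬ G.Adj x z) ∧
    G.HasPathAvoidingNeighborhood x y z ∧ G.HasPathAvoidingNeighborhood y z x ∧
    G.HasPathAvoidingNeighborhood x z y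

/-- `G` contains an asteroidal triple. -/
def HasAsteroidalTriple {V : Type*} (G : SimpleGraph V) : Prop :=
  ∃ x y z : V, G.IsAsteroidalTriple x y z

theorem toughness_top {V : Type*} : (⊤ : SimpleGraph V).toughness = ⊤ := by
  have h : {t : ℝ | (⊤ : SimpleGraph V).IsTough t} = Set.univ := by
    refine Set.eq_univ_of_forall fun t S hS => ?_
    exfalso
    have hsub : Subsingleton ((⊤ : SimpleGraph V).induce Sᶜ).ConnectedComponent := by
      refine ⟨fun a b => ?_⟩
      induction a using ConnectedComponent.ind with | _ a =>
      induction b using ConnectedComponent.ind with | _ b =>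
      by_cases hab : a = b
      · rw [hab]
      · refine ConnectedComponent.sound (Adj.reachable ?_)
        simpa [Subtype.ext_iff] using hab
    have := Finite.card_le_one_iff_subsingleton.mpr hsub
    unfold numComponentsDelete at hS
    omega
  rw [toughness, h, Set.image_univ]
  refine EReal.eq_top_iff_forall_lt _ |>.mpr fun y => ?_
  exact lt_of_lt_of_le (EReal.coe_lt_coe_iff.mpr (lt_add_one y)) (le_sSup ⟨y + 1, rfl⟩)

theorem isGreatest_toughness {V : Type*} [Finite V] (G : SimpleGraph V) (hG : G ≠ ⊤) :
    ∃ t : ℝ, IsGreatest {s : ℝ | G.IsTough s} t ∧ G.toughness = (t : EReal) := by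
  have hne : {s : ℝ | G.IsTough s}.Nonempty := ⟨0, fun S _ => by simp⟩
  have hcl : IsClosed {s : ℝ | G.IsTough s} := by
    simp only [IsTough, Set.ofPred_forall]
    exact isClosed_iInter fun S => isClosed_iInter fun _ =>
      isClosed_le (by fun_prop) continuous_const
  obtain ⟨u, v, huv, hadj⟩ : ∃ u v, u ≠ v ∧ ¬ G.Adj u v := by
    by_contra! h
    exact hG (by ext a b; exact ⟨fun h' => h'.ne, fun h' => h a b h'⟩)
  have hbd : BddAbove {s : ℝ | G.IsTough s} := by
    have hbot : G.induce ({u, v}ᶜᶜ : Set V) = ⊥ := by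
      ext ⟨a, ha⟩ ⟨b, hb⟩
      have hadj' : ¬ G.Adj v u := fun h => hadj h.symm
      simp only [compl_compl, Set.mem_insert_iff, Set.mem_singleton_iff] at ha hb
      rcases ha with rfl | rfl <;> rcases hb with rfl | rfl <;> simp [hadj, hadj']
    have hcard : 1 < G.numComponentsDelete {u, v}ᶜ := by
      unfold numComponentsDelete
      rw [hbot, Finite.one_lt_card_iff_nontrivial]
      refine ⟨connectedComponentMk _ ⟨u, by simp⟩, connectedComponentMk _ ⟨v, by simp⟩, ?_⟩
      rw [Ne, ConnectedComponent.eq, reachable_bot]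
      simpa using huv
    refine ⟨(({u, v}ᶜ : Set V).ncard : ℝ), fun s hs => ?_⟩
    have h1 := hs _ hcard
    have h2 : (1 : ℝ) ≤ (G.numComponentsDelete {u, v}ᶜ : ℝ) := by exact_mod_cast hcard.le
    by_contra! h3
    have h4 : (0 : ℝ) ≤ (({u, v}ᶜ : Set V).ncard : ℝ) := Nat.cast_nonneg _
    nlinarith
  have hgr : IsGreatest {s : ℝ | G.IsTough s} (sSup {s : ℝ | G.IsTough s}) :=
    ⟨hcl.csSup_mem hne hbd, fun s hs => le_csSup hbd hs⟩
  refine ⟨_, hgr, IsGreatest.csSup_eq ⟨⟨_, hgr.1, rfl⟩, ?_⟩⟩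
  rintro _ ⟨s, hs, rfl⟩
  exact EReal.coe_le_coe_iff.mpr (hgr.2 hs)

end SimpleGraph

namespace SimpleGraph

/-! ### Counting components and deleting an edge -/

variable {V : Type*} {G : SimpleGraph V}

/-! Both parts rest on one obstruction: for `t > 1/2`, a minimally `t`-tough graph has no simplicial
vertex `u` with a maximum neighbor `v`. Let `w ≠ v` be another neighbor of `u`. Deleting the edge
`wv` violates toughness at some `S`; since `N[w] ⊆ N[v]`, `w` is isolated in what remains. Returning
`N[u] \ {w, v}` to the graph costs at most one component, because everything returned has its
neighbors in `N[v]`. Toughness of `G` then forces `deg w ≤ deg u`, so `w` is a twin of `u`. As this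
holds for each `w`, `v` is a cut vertex, which contradicts `t > 1/2`.

Such a pair exists in interval graphs by looking at right endpoints, and in connected noncomplete
graphs without holes and asteroidal triples by an extremal choice of a connected set far from a
simplicial vertex (`exists_isMaximumNeighbor`). -/

theorem ncard_le_numComponentsDelete [Finite V] {K : Type*} {S : Set V} (T : Set K) (r : V → K)
    (hr : ∀ x y, x ∉ S → y ∉ S → G.Adj x y → r x = r y) (hT : ∀ c ∈ T, ∃ x ∉ S, r x = c) :
    T.ncard ≤ G.numComponentsDelete S := by
  have hwalk : ∀ (x y : (Sᶜ : Set V)) (p : (G.induce Sᶜ).Walk x y), r x = r y := by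
    intro x y p
    induction p with
    | nil => rfl
    | @cons a b _ hab _ ih => exact (hr a b a.2 b.2 hab).trans ih
  let f : (G.induce Sᶜ).ConnectedComponent → K :=
    ConnectedComponent.lift (fun x => r x) fun x y p _ => hwalk x y p
  have hsub : T ⊆ Set.range f := fun c hc => by
    obtain ⟨x, hx, rfl⟩ := hT c hc
    exact ⟨connectedComponentMk _ ⟨x, hx⟩, rfl⟩
  calc T.ncard ≤ (Set.range f).ncard := Set.ncard_le_ncard hsub
    _ ≤ (Set.univ : Set (G.induce Sᶜ).ConnectedComponent).ncard := by
        rw [← Set.image_univ]; exact Set.ncard_image_le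
    _ = G.numComponentsDelete S := Set.ncard_univ _

/-- A vertex set whose deletion separates `x` from `y` leaves at least two components. -/
theorem one_lt_numComponentsDelete [Finite V] {S A : Set V} {x y : V} (hxA : x ∈ A) (hyA : y ∉ A)
    (hx : x ∉ S) (hy : y ∉ S)
    (hA : ∀ a b, a ∈ A → b ∉ A → G.Adj a b → a ∈ S ∨ b ∈ S) : 1 < G.numComponentsDelete S := by
  classical
  have h := ncard_le_numComponentsDelete (G := G) (S := S) (Set.univ : Set Prop) (fun a => a ∈ A)
    (fun a b ha hb hab => by
      by_cases h1 : a ∈ A <;> by_cases h2 : b ∈ A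
      · simp [h1, h2]
      · exact absurd (hA a b h1 h2 hab) (by tauto)
      · exact absurd (hA b a h2 h1 hab.symm) (by tauto)
      · simp [h1, h2])
    (fun c _ => by
      by_cases hc : c
      · exact ⟨x, hx, by simp [hxA, hc]⟩
      · exact ⟨y, hy, by simp [hyA, hc]⟩)
  rw [Set.ncard_univ, Nat.card_eq_fintype_card, Fintype.card_prop] at h
  omega

theorem IsMinimallyTough.ne_top {t : ℝ} (h : G.IsMinimallyTough (t : EReal)) : G ≠ ⊤ := by
  rintro rfl
  exact EReal.coe_ne_top t (h.1.symm.trans toughness_top)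

theorem IsMinimallyTough.isTough [Finite V] {t : ℝ} (h : G.IsMinimallyTough (t : EReal)) :
    G.IsTough t := by
  obtain ⟨s, hs, hs'⟩ := isGreatest_toughness G h.ne_top
  rw [h.1, EReal.coe_eq_coe_iff] at hs'
  exact hs' ▸ hs.1

/-- In a minimally `t`-tough graph, deleting an edge violates `t`-toughness at a vertex set that
avoids the edge and separates its endpoints from each other. -/
theorem IsMinimallyTough.exists_of_adj [Finite V] {t : ℝ} (h : G.IsMinimallyTough (t : EReal))
    {w v : V} (hwv : G.Adj w v) :
    ∃ S : Set V, 1 < (G.deleteEdges {s(w, v)}).numComponentsDelete S ∧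
      (S.ncard : ℝ) < t * ((G.deleteEdges {s(w, v)}).numComponentsDelete S : ℝ) ∧
      ∃ (hw : w ∉ S) (hv : v ∉ S),
        ¬ ((G.deleteEdges {s(w, v)}).induce Sᶜ).Reachable ⟨w, hw⟩ ⟨v, hv⟩ := by
  set H := G.deleteEdges {s(w, v)} with hH
  have hnt : ¬ H.IsTough t := fun ht =>
    absurd (h.2 s(w, v) hwv) (not_lt.mpr (le_sSup ⟨t, ht, rfl⟩))
  unfold IsTough at hnt
  push Not at hnt
  obtain ⟨S, hS1, hS2⟩ := hnt
  refine ⟨S, hS1, hS2, ?_⟩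
  by_contra hcon
  push Not at hcon
  have hadj : ∀ x y, G.Adj x y → s(x, y) ≠ s(w, v) → H.Adj x y := fun x y hxy hne => by
    simp [hH, hxy, hne]
  classical
  obtain ⟨a, -⟩ : (Set.univ : Set (H.induce Sᶜ).ConnectedComponent).Nonempty := by
    rw [← Set.ncard_pos, Set.ncard_univ]
    exact lt_trans zero_lt_one hS1
  -- Restoring `wv` merges no components if it meets `S` or its ends are already connected, so `S`
  -- would violate the toughness of `G`. The label `a` on `S` is a dummy.
  have hle := ncard_le_numComponentsDelete (G := G) (S := S)
    (Set.univ : Set (H.induce Sᶜ).ConnectedComponent)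
    (fun x => if hx : x ∈ S then a else connectedComponentMk _ ⟨x, hx⟩)
    (fun x y hx hy hxy => by
      simp only [hx, hy, dite_false, ConnectedComponent.eq]
      by_cases hne : s(x, y) = s(w, v)
      · rcases Sym2.eq_iff.mp hne with ⟨rfl, rfl⟩ | ⟨rfl, rfl⟩
        · exact hcon hx hy
        · exact (hcon hy hx).symm
      · exact Adj.reachable (by simpa using hadj x y hxy hne))
    (fun c _ => by
      induction c using ConnectedComponent.ind with | _ x =>
      exact ⟨x, x.2, by simp [show (x : V) ∉ S from x.2]⟩)
  rw [Set.ncard_univ] at hle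
  change H.numComponentsDelete S ≤ G.numComponentsDelete S at hle
  have h1 := h.isTough S (hS1.trans_le hle)
  have h0 : (0 : ℝ) < t := by
    by_contra! h0
    have := mul_nonpos_of_nonpos_of_nonneg h0 (Nat.cast_nonneg (H.numComponentsDelete S))
    have := Nat.cast_nonneg (α := ℝ) S.ncard
    linarith
  have h2 : (H.numComponentsDelete S : ℝ) ≤ G.numComponentsDelete S := by exact_mod_cast hle
  nlinarith

/-! ### Simplicial vertices with a maximum neighbor -/

/-- The closed neighborhood of every neighbor of `u` is contained in that of `v`. -/
def IsMaximumNeighbor (G : SimpleGraph V) (u v : V) : Prop :=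
  G.Adj u v ∧ ∀ w, G.Adj u w → ∀ x, G.Adj w x → x = v ∨ G.Adj v x

theorem IsMinimallyTough.two_mul_le_ncard_neighborSet [Finite V] {t : ℝ}
    (h : G.IsMinimallyTough (t : EReal)) {u z : V} (hzu : z ≠ u) (hz : ¬ G.Adj u z) :
    2 * t ≤ (G.neighborSet u).ncard := by
  have h1 : 1 < G.numComponentsDelete (G.neighborSet u) :=
    one_lt_numComponentsDelete (A := {u}) (x := u) (y := z) rfl (by simpa using hzu) (by simp)
      (by simpa using hz) (by rintro a b rfl - hab; exact Or.inr hab)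
  have h2 := h.isTough _ h1
  rcases le_total t 0 with h0 | h0
  · have := Nat.cast_nonneg (α := ℝ) (G.neighborSet u).ncard
    linarith
  · have h3 : (2 : ℝ) ≤ G.numComponentsDelete (G.neighborSet u) := by exact_mod_cast h1
    nlinarith

theorem IsMinimallyTough.ncard_neighborSet_le [Finite V] {t : ℝ}
    (h : G.IsMinimallyTough (t : EReal)) (ht : 1 / 2 < t) {u v w : V}
    (hd : 2 * t ≤ (G.neighborSet u).ncard)
    (hu : G.IsClique (G.neighborSet u)) (hv : G.IsMaximumNeighbor u v) (huw : G.Adj u w)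
    (hwv : w ≠ v) : (G.neighborSet w).ncard ≤ (G.neighborSet u).ncard := by
  classical
  have hadj : G.Adj w v := hu huw hv.1 hwv
  obtain ⟨S, hS1, hS2, hw, hvS, hnr⟩ := h.exists_of_adj hadj
  set H := G.deleteEdges {s(w, v)} with hH
  have hHadj : ∀ x y, G.Adj x y → s(x, y) ≠ s(w, v) → H.Adj x y := fun x y hxy hne => by
    simp [hH, hxy, hne]
  -- A common neighbor of `w` and `v` outside `S` would reconnect them, so `w` is isolated in `H -
  -- S`.
  have hwS : ∀ x, G.Adj w x → x ≠ v → x ∈ S := by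
    intro x hwx hxv
    by_contra hxS
    have hvx : G.Adj v x := (hv.2 w huw x hwx).resolve_left hxv
    have h1 : (H.induce Sᶜ).Adj ⟨w, hw⟩ ⟨x, hxS⟩ := hHadj w x hwx (by simp [hxv, hwv])
    have h2 : (H.induce Sᶜ).Adj ⟨x, hxS⟩ ⟨v, hvS⟩ := hHadj x v hvx.symm (by simp [hxv, hwx.ne'])
    exact hnr (h1.reachable.trans h2.reachable)
  set B : Set V := insert u (G.neighborSet u) \ {w, v} with hB
  have hBcard : B.ncard + 1 = (G.neighborSet u).ncard := by
    have h1 : ({w, v} : Set V) ⊆ insert u (G.neighborSet u) := by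
      rintro x (rfl | rfl)
      · exact Or.inr huw
      · exact Or.inr hv.1
    have h2 := Set.ncard_sdiff_add_ncard_of_subset h1
    rw [Set.ncard_pair hwv, Set.ncard_insert_of_notMem (by simp), ← hB] at h2
    omega
  have hBv : ∀ x ∈ B, ∀ y, G.Adj x y → y = v ∨ G.Adj v y := by
    rintro x ⟨rfl | hx, -⟩ y hxy
    · by_cases hyv : y = v
      · exact Or.inl hyv
      · exact Or.inr (hu hv.1 hxy (Ne.symm hyv))
    · exact hv.2 x hx y hxy
  have hBS : B ⊆ S := by
    rintro x ⟨hx, hx'⟩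
    simp only [Set.mem_insert_iff, Set.mem_singleton_iff, not_or] at hx'
    refine hwS x ?_ hx'.2
    rcases hx with rfl | hx
    · exact huw.symm
    · exact hu huw hx (Ne.symm hx'.1)
  have hS' : (S \ B).ncard + B.ncard = S.ncard := Set.ncard_sdiff_add_ncard_of_subset hBS
  let cv : (H.induce Sᶜ).ConnectedComponent := connectedComponentMk _ ⟨v, hvS⟩
  let cw : (H.induce Sᶜ).ConnectedComponent := connectedComponentMk _ ⟨w, hw⟩
  -- Vertices of `B` and `w` have all their neighbors in `N[v]`, so labelling them with the
  -- component of `v` is consistent across the edges of `G - (S \ B)`. Only the label `cw` is lost.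
  let r : V → (H.induce Sᶜ).ConnectedComponent := fun x =>
    if hx : x ∈ S ∨ x = w then cv else connectedComponentMk _ ⟨x, fun h => hx (Or.inl h)⟩
  have hrv : ∀ y, (y = v ∨ G.Adj v y) → r y = cv := by
    intro y hy
    by_cases hyS : y ∈ S ∨ y = w
    · simp [r, hyS]
    · simp only [r, hyS, dite_false, cv, ConnectedComponent.eq]
      push Not at hyS
      rcases hy with rfl | hy
      · exact Reachable.refl _
      · have : (H.induce Sᶜ).Adj ⟨v, hvS⟩ ⟨y, hyS.1⟩ :=
          hHadj v y hy (by simp [hyS.2, Ne.symm hwv])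
        exact this.symm.reachable
  have hle : ({cw}ᶜ : Set (H.induce Sᶜ).ConnectedComponent).ncard ≤
      G.numComponentsDelete (S \ B) := by
    refine ncard_le_numComponentsDelete _ r (fun x y hx hy hxy => ?_) (fun c hc => ?_)
    · have key : ∀ x y, x ∉ S \ B → G.Adj x y → (x ∈ S ∨ x = w) → r x = r y := by
        intro x y hx hxy hxS
        rw [show r x = cv by simp [r, hxS], hrv]
        rcases hxS with hxS | rfl
        · exact hBv x (by by_contra hxB; exact hx ⟨hxS, hxB⟩) y hxy
        · exact hv.2 x huw y hxy
      by_cases hxS : x ∈ S ∨ x = w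
      · exact key x y hx hxy hxS
      by_cases hyS : y ∈ S ∨ y = w
      · exact (key y x hy hxy.symm hyS).symm
      simp only [r, hxS, hyS, dite_false, ConnectedComponent.eq]
      push Not at hxS hyS
      exact Adj.reachable (hHadj x y hxy (by simp [hxS.2, hyS.2]))
    · induction c using ConnectedComponent.ind with | _ x =>
      have hxS : ¬ ((x : V) ∈ S ∨ (x : V) = w) := by
        rintro (hx | hx)
        · exact x.2 hx
        · exact hc (by simp [cw, ← hx])
      exact ⟨x, fun hx => hxS (Or.inl hx.1), by simp [r, hxS]⟩
  have hcard : ({cw}ᶜ : Set (H.induce Sᶜ).ConnectedComponent).ncard + 1 =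
      H.numComponentsDelete S := by
    have := Set.ncard_add_ncard_compl ({cw} : Set (H.induce Sᶜ).ConnectedComponent)
    rw [Set.ncard_singleton] at this
    unfold numComponentsDelete
    omega
  set m := H.numComponentsDelete S
  set m' := G.numComponentsDelete (S \ B) with hm'
  have hm : m ≤ m' + 1 := by omega
  rcases lt_or_ge 1 m' with h1 | h1
  -- Comparing `S` with `S \ B` gives `|B| < t`, whereas `|B| + 1 = deg u ≥ 2t > 1` gives `|B| ≥ 1`
  -- and then `t < 1`.
  · exfalso
    have h2 := h.isTough (S \ B) h1
    rw [← hm'] at h2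
    have h3 : (m : ℝ) ≤ m' + 1 := by exact_mod_cast hm
    have h4 : ((S \ B).ncard : ℝ) + B.ncard = S.ncard := by exact_mod_cast hS'
    have h5 : (B.ncard : ℝ) + 1 = (G.neighborSet u).ncard := by exact_mod_cast hBcard
    have h6 : t * m ≤ t * (m' + 1) := mul_le_mul_of_nonneg_left h3 (by linarith)
    have h7 : (B.ncard : ℝ) < t := by linarith
    have h8 : (1 : ℝ) < (G.neighborSet u).ncard := by linarith
    have h9 : 2 ≤ (G.neighborSet u).ncard := by exact_mod_cast h8
    have h10 : (1 : ℝ) ≤ B.ncard := by exact_mod_cast (by omega : 1 ≤ B.ncard)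
    linarith
  · have h2 : m = 2 := by omega
    rw [h2] at hS2
    have h3 : (S.ncard : ℝ) < (G.neighborSet u).ncard := by push_cast at hS2; linarith
    have h4 : S.ncard < (G.neighborSet u).ncard := by exact_mod_cast h3
    have h5 : (G.neighborSet w \ {v}).ncard ≤ S.ncard :=
      Set.ncard_le_ncard fun x hx => hwS x hx.1 hx.2
    have h6 : (G.neighborSet w \ {v}).ncard + 1 = (G.neighborSet w).ncard :=
      Set.ncard_sdiff_singleton_add_one hadj
    omega

/-- A graph with a simplicial vertex that has a maximum neighbor is not minimally `t`-tough for
any `t > 1/2`. -/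
theorem IsMaximumNeighbor.not_isMinimallyTough [Finite V] {t : ℝ} (ht : 1 / 2 < t) {u v : V}
    (hv : G.IsMaximumNeighbor u v) (hu : G.IsClique (G.neighborSet u)) :
    ¬ G.IsMinimallyTough (t : EReal) := by
  intro h
  obtain ⟨z, hzu, hz⟩ : ∃ z, z ≠ u ∧ ¬ G.Adj u z := by
    by_contra! hcon
    refine h.ne_top ?_
    ext a b
    refine ⟨fun hab => hab.ne, fun hab => ?_⟩
    by_cases ha : a = u
    · exact ha ▸ hcon b (fun hb => hab (ha.trans hb.symm))
    by_cases hb : b = u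
    · exact hb ▸ (hcon a ha).symm
    exact hu (hcon a ha) (hcon b hb) hab
  have hd := h.two_mul_le_ncard_neighborSet hzu hz
  -- The degree bound turns `N[u] ⊆ N[w]` into equality.
  have htwin : ∀ w, G.Adj u w → w ≠ v → ∀ x, G.Adj w x → x = u ∨ G.Adj u x := by
    intro w huw hwv x hwx
    have hle := h.ncard_neighborSet_le ht hd hu hv huw hwv
    have hsub : insert u (G.neighborSet u) ⊆ insert w (G.neighborSet w) := by
      rintro y (rfl | hy)
      · exact Or.inr huw.symm
      · by_cases hyw : y = w
        · exact Or.inl hyw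
        · exact Or.inr (hu huw hy (Ne.symm hyw))
    have heq := Set.eq_of_subset_of_ncard_le hsub (by
      rw [Set.ncard_insert_of_notMem (by simp), Set.ncard_insert_of_notMem (by simp)]
      omega)
    have : x ∈ insert u (G.neighborSet u) := heq ▸ Or.inr hwx
    exact this
  have h1 : 1 < G.numComponentsDelete {v} := by
    refine one_lt_numComponentsDelete (A := insert u (G.neighborSet u)) (x := u) (y := z)
      (Or.inl rfl) (by simp [hzu, hz]) hv.1.ne (fun hzv => hz ((show z = v from hzv) ▸ hv.1)) ?_
    intro a b ha hb hab
    by_contra hcon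
    simp only [Set.mem_singleton_iff, not_or] at hcon
    refine hb ?_
    rcases ha with rfl | ha
    · exact Or.inr hab
    · exact htwin a ha hcon.1 b hab
  have h2 := h.isTough _ h1
  rw [Set.ncard_singleton] at h2
  have h3 : (2 : ℝ) ≤ G.numComponentsDelete {v} := by exact_mod_cast h1
  push_cast at h2
  nlinarith

/-! ### Interval graphs -/

/-- Take `u` with the leftmost right endpoint: its neighbors all contain that point. Among them, let
`v` reach furthest right. -/
theorem IsIntervalGraph.exists_isMaximumNeighbor [Finite V] (h : G.IsIntervalGraph)
    (hG : ∀ u, ∃ v, G.Adj u v) [Nonempty V] :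
    ∃ u v, G.IsClique (G.neighborSet u) ∧ G.IsMaximumNeighbor u v := by
  obtain ⟨l, r, hlr, hadj⟩ := h
  obtain ⟨u, hu⟩ := Finite.exists_min r
  obtain ⟨v, hv, hvmax⟩ := (Set.toFinite (G.neighborSet u)).exists_maximalFor r _ (hG u)
  have hvmax' : ∀ w, G.Adj u w → r w ≤ r v := fun w hw => by
    by_contra! hlt
    exact absurd (hvmax hw hlt.le) (not_le.mpr hlt)
  have hmeet : ∀ x y, (Set.Icc (l x) (r x) ∩ Set.Icc (l y) (r y)).Nonempty ↔
      l x ≤ r y ∧ l y ≤ r x := by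
    intro x y
    constructor
    · rintro ⟨a, ha, hb⟩
      exact ⟨ha.1.trans hb.2, hb.1.trans ha.2⟩
    · rintro ⟨h1, h2⟩
      exact ⟨max (l x) (l y), ⟨le_max_left _ _, max_le (hlr x) h2⟩,
        ⟨le_max_right _ _, max_le h1 (hlr y)⟩⟩
  simp only [hmeet] at hadj
  refine ⟨u, v, fun x hx y hy hxy => ?_, hv, fun w hw x hwx => ?_⟩
  · rw [mem_neighborSet, hadj] at hx hy
    exact (hadj x y).mpr ⟨hxy, hx.2.2.trans (hu y), hy.2.2.trans (hu x)⟩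
  · by_cases hxv : x = v
    · exact Or.inl hxv
    have h1 := (hadj w x).mp hwx
    have h2 := (hadj u v).mp hv
    exact Or.inr ((hadj v x).mpr ⟨Ne.symm hxv, h2.2.2.trans (hu x), h1.2.2.trans (hvmax' w hw)⟩)

/-! ### Simplicial vertices in hole-free graphs -/

theorem induce_insert_connected {D : Set V} (hD : (G.induce D).Connected) {x d : V} (hd : d ∈ D)
    (hdx : G.Adj d x) : (G.induce (insert x D)).Connected := by
  have := induce_union_connected (G.induce_pair_connected_of_adj hdx).preconnected hD.preconnected
    ⟨d, by simp, hd⟩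
  rwa [show ({d, x} ∪ D : Set V) = insert x D by ext; simp; grind] at this

theorem exists_adj_of_induce_connected {F A : Set V} (hF : (G.induce F).Connected) {x y : V}
    (hx : x ∈ F) (hy : y ∈ F) (hxA : x ∈ A) (hyA : y ∉ A) :
    ∃ a b, a ∈ F ∧ b ∈ F ∧ a ∈ A ∧ b ∉ A ∧ G.Adj a b := by
  obtain ⟨p⟩ := hF.preconnected ⟨x, hx⟩ ⟨y, hy⟩
  obtain ⟨d, -, h1, h2⟩ := p.exists_boundary_dart (Subtype.val ⁻¹' A) hxA hyA
  exact ⟨d.fst, d.snd, d.fst.2, d.snd.2, h1, h2, d.adj⟩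

/-- The component of `x` in the graph without the closed neighborhood of `a`. -/
theorem exists_component_avoiding [Finite V] {a x : V} (hxa : x ≠ a) (hax : ¬ G.Adj a x) :
    ∃ E : Set V, x ∈ E ∧ (G.induce E).Connected ∧ (∀ y ∈ E, y ≠ a ∧ ¬ G.Adj a y) ∧
      ∀ y ∈ E, ∀ z, z ∉ E → G.Adj y z → G.Adj a z := by
  obtain ⟨E, hE⟩ := (Set.toFinite {E : Set V | x ∈ E ∧ (G.induce E).Connected ∧
    ∀ y ∈ E, y ≠ a ∧ ¬ G.Adj a y}).exists_maximal ⟨{x}, rfl, by simp, by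
      rintro y rfl; exact ⟨hxa, hax⟩⟩
  refine ⟨E, hE.prop.1, hE.prop.2.1, hE.prop.2.2, fun y hy z hz hyz => ?_⟩
  by_contra haz
  refine hz (hE.le_of_ge (y := insert z E) ⟨Or.inr hE.prop.1,
    induce_insert_connected hE.prop.2.1 hy hyz, ?_⟩ (Set.subset_insert _ _) (Or.inl rfl))
  rintro w (rfl | hw)
  · refine ⟨?_, haz⟩
    rintro rfl
    exact (hE.prop.2.2 y hy).2 hyz.symm
  · exact hE.prop.2.2 w hw

/-- In a hole-free graph, two neighbors of `a` with neighbors in a common connected set avoiding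
the closed neighborhood of `a` are adjacent. -/
theorem adj_of_not_hasHole (hG : ¬ G.HasHole) {E : Set V} (hE : (G.induce E).Connected) {a : V}
    (ha : a ∉ E) (haE : ∀ y ∈ E, ¬ G.Adj a y) {k₁ k₂ : V} (hne : k₁ ≠ k₂)
    (h₁ : G.Adj a k₁) (h₂ : G.Adj a k₂) {e₁ e₂ : V} (he₁ : e₁ ∈ E) (he₂ : e₂ ∈ E)
    (hk₁ : G.Adj e₁ k₁) (hk₂ : G.Adj e₂ k₂) : G.Adj k₁ k₂ := by
  by_contra hnadj
  set F : Set V := insert k₂ (insert k₁ E) with hF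
  have hFc : (G.induce F).Connected :=
    induce_insert_connected (induce_insert_connected hE he₁ hk₁) (Or.inr he₂) hk₂
  let s : F := ⟨k₁, by simp [hF]⟩
  let e : F := ⟨k₂, by simp [hF]⟩
  obtain ⟨p, -, hp⟩ := hFc.exists_path_of_dist s e
  set n := p.length with hn
  -- Distance from `k₁` grows by one along a shortest path, so the path is induced; `a` sees only
  -- its ends and closes it to a hole of length `n + 2`.
  have hdist : ∀ i ≤ n, (G.induce F).dist s (p.getVert i) = i := by
    intro i hi
    have h1 : (G.induce F).dist s (p.getVert i) ≤ i := by
      exact (dist_le (p.take i)).trans (by simp)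
    have h2 : (G.induce F).dist (p.getVert i) e ≤ n - i := by
      simpa using dist_le (p.drop i)
    have h3 := hFc.dist_triangle (u := s) (v := p.getVert i) (w := e)
    omega
  have hn2 : 2 ≤ n := by
    by_contra! hlt
    have h0 : n ≠ 0 := by
      intro h0
      rw [h0] at hp
      exact hne (congrArg Subtype.val ((hFc.preconnected s e).dist_eq_zero_iff.mp hp.symm))
    have h1 : (G.induce F).dist s e = 1 := by omega
    have h2 : (G.induce F).Adj s e := dist_eq_one_iff_adj.mp h1
    exact hnadj h2
  let q : ℕ → V := fun i => (p.getVert i : V)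
  have hq0 : q 0 = k₁ := by simp [q, s]
  have hqn : q n = k₂ := by simp [q, e, hn]
  have hqinj : ∀ i ≤ n, ∀ j ≤ n, q i = q j → i = j := by
    intro i hi j hj hij
    rw [← hdist i hi, ← hdist j hj, Subtype.ext hij]
  have hqadj : ∀ i ≤ n, ∀ j ≤ n, (G.Adj (q i) (q j) ↔ i + 1 = j ∨ j + 1 = i) := by
    intro i hi j hj
    constructor
    · intro hij
      have hij' : (G.induce F).Adj (p.getVert i) (p.getVert j) := hij
      have h1 := hFc.dist_triangle (u := s) (v := p.getVert i) (w := p.getVert j)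
      have h2 := hFc.dist_triangle (u := s) (v := p.getVert j) (w := p.getVert i)
      rw [dist_eq_one_iff_adj.mpr hij', hdist i hi, hdist j hj] at h1
      rw [dist_eq_one_iff_adj.mpr hij'.symm, hdist i hi, hdist j hj] at h2
      have : i ≠ j := by rintro rfl; exact hij.ne rfl
      omega
    · rintro (rfl | rfl)
      · exact p.adj_getVert_succ (by omega)
      · exact (p.adj_getVert_succ (by omega)).symm
  have hqa : ∀ i ≤ n, (G.Adj a (q i) ↔ i = 0 ∨ i = n) := by
    intro i hi
    constructor
    · intro hai
      by_contra! hcon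
      have h3 : q i ∈ F := (p.getVert i).2
      rcases h3 with h3 | h3 | h3
      · exact hcon.2 (hqinj i hi n le_rfl (h3.trans hqn.symm))
      · exact hcon.1 (hqinj i hi 0 (by omega) (h3.trans hq0.symm))
      · exact haE _ h3 hai
    · rintro (rfl | rfl)
      · rwa [hq0]
      · rwa [hqn]
  have hqne : ∀ i, q i ≠ a := by
    intro i hi
    rcases (p.getVert i).2 with h3 | h3 | h3
    · exact h₂.ne (hi.symm.trans h3)
    · exact h₁.ne (hi.symm.trans h3)
    · exact ha (hi ▸ h3)
  let f : Fin (n + 2) → V := fun i => if (i : ℕ) = n + 1 then a else q i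
  refine hG ⟨n + 2, by omega, ⟨⟨⟨f, ?_⟩, ?_⟩⟩⟩
  · intro i j hij
    have := i.2
    have := j.2
    simp only [f] at hij
    split_ifs at hij with h1 h2 h2
    · exact Fin.ext (by omega)
    · exact absurd hij.symm (hqne _)
    · exact absurd hij (hqne _)
    · exact Fin.ext (hqinj _ (by omega) _ (by omega) hij)
  · intro i j
    have hi := i.2
    have hj := j.2
    change G.Adj (f i) (f j) ↔ _
    have hsub : ∀ i j : Fin (n + 2), (((i - j : Fin (n + 2)) : ℕ) = 1 ↔
        (j : ℕ) + 1 = i ∨ ((i : ℕ) = 0 ∧ (j : ℕ) = n + 1)) := by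
      intro i j
      have hi := i.2
      have hj := j.2
      rcases le_or_gt j i with h | h
      · rw [Fin.coe_sub_iff_le.mpr h]
        have h' : (j : ℕ) ≤ i := h
        omega
      · rw [Fin.coe_sub_iff_lt.mpr h]
        have h' : (i : ℕ) < j := h
        omega
    rw [cycleGraph_adj', hsub, hsub]
    simp only [f]
    split_ifs with h1 h2 h2
    · simp only [G.irrefl, false_iff]
      omega
    · rw [hqa _ (by omega)]
      omega
    · rw [G.adj_comm, hqa _ (by omega)]
      omega
    · rw [hqadj _ (by omega) _ (by omega)]
      omega

/-- If `x` lies outside the closed neighborhood of `a` in a hole-free graph, then its component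
there contains a simplicial vertex. -/
theorem exists_isClique_neighborSet [Finite V] (hG : ¬ G.HasHole) {a x : V} (hxa : x ≠ a)
    (hax : ¬ G.Adj a x) :
    ∃ (F : Set V) (u : V), x ∈ F ∧ u ∈ F ∧ (G.induce F).Connected ∧
      (∀ y ∈ F, y ≠ a ∧ ¬ G.Adj a y) ∧ G.IsClique (G.neighborSet u) := by
  obtain ⟨F, hxF, hFc, hFa, hFb⟩ := exists_component_avoiding hxa hax
  -- Take a minimal connected `E` whose boundary is dominated by one outside vertex `b`. It will
  -- turn out that `E` and its boundary together form a clique.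
  obtain ⟨E, ⟨hEF, ⟨y₀, hy₀⟩, hEc, b, hbE, hEb⟩, hmin⟩ := (Set.toFinite {E : Set V | E ⊆ F ∧
    E.Nonempty ∧ (G.induce E).Connected ∧ ∃ b, b ∉ E ∧
      ∀ y ∈ E, ∀ z, z ∉ E → G.Adj y z → G.Adj b z}).exists_minimal
    ⟨F, subset_rfl, ⟨x, hxF⟩, hFc, a, fun h => (hFa a h).1 rfl, hFb⟩
  have hEb' : ∀ y ∈ E, ¬ G.Adj b y := fun y hy hby => (hEb y hy b hbE hby.symm).ne rfl
  -- if `c` meets the closed neighborhood of `E` and dominates its boundary, it dominates `E`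
  have key : ∀ c, (∃ y ∈ E, y = c ∨ G.Adj y c) →
      (∀ y ∈ E, ∀ z, z ∉ E → G.Adj y z → z = c ∨ G.Adj c z) → ∀ y ∈ E, y ≠ c → G.Adj c y := by
    rintro c ⟨y₁, hy₁, hy₁c⟩ hc y hy hyc
    by_contra hcy
    -- This component cannot cross the boundary of `E`, which lies in `N[c]`, and it misses `y₁`; it
    -- is a smaller candidate than `E`.
    obtain ⟨E', hyE', hE'c, hE'a, hE'b⟩ := exists_component_avoiding hyc hcy
    have hsub : E' ⊆ E := by
      intro z hz
      by_contra hzE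
      obtain ⟨p, q, -, hq, hpE, hqE, hpq⟩ := exists_adj_of_induce_connected hE'c hyE' hz hy hzE
      rcases hc p hpE q hqE hpq with h | h
      · exact (hE'a q hq).1 h
      · exact (hE'a q hq).2 h
    have := hmin ⟨hsub.trans hEF, ⟨y, hyE'⟩, hE'c, c, fun h => (hE'a c h).1 rfl, hE'b⟩ hsub hy₁
    rcases hy₁c with rfl | h
    · exact (hE'a _ this).1 rfl
    · exact (hE'a _ this).2 h.symm
  have hbd : ∀ k, k ∉ E → ∀ e ∈ E, G.Adj e k → ∀ k', k' ∉ E → ∀ e' ∈ E, G.Adj e' k' →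
      k' = k ∨ G.Adj k k' := by
    intro k hk e he hek k' hk' e' he' hek'
    by_cases hkk : k' = k
    · exact Or.inl hkk
    · exact Or.inr (adj_of_not_hasHole hG hEc hbE hEb' (Ne.symm hkk) (hEb e he k hk hek)
        (hEb e' he' k' hk' hek') he he' hek hek')
  have hout : ∀ k, k ∉ E → ∀ e ∈ E, G.Adj e k → ∀ y ∈ E, G.Adj k y := by
    intro k hk e he hek y hy
    exact key k ⟨e, he, Or.inr hek⟩
      (fun y' hy' z hz hyz => hbd k hk e he hek z hz y' hy' hyz) y hy (by rintro rfl; exact hk hy)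
  have hin : ∀ c ∈ E, ∀ y ∈ E, y ≠ c → G.Adj c y := by
    intro c hc
    exact key c ⟨c, hc, Or.inl rfl⟩ fun y hy z hz hyz => Or.inr (hout z hz y hy hyz c hc).symm
  refine ⟨F, y₀, hxF, hEF hy₀, hFc, hFa, fun p hp q hq hpq => ?_⟩
  by_cases hpE : p ∈ E
  · by_cases hqE : q ∈ E
    · exact hin p hpE q hqE (Ne.symm hpq)
    · exact (hout q hqE y₀ hy₀ hq p hpE).symm
  · by_cases hqE : q ∈ E
    · exact hout p hpE y₀ hy₀ hp q hqE
    · exact (hbd p hpE y₀ hy₀ hp q hqE y₀ hy₀ hq).resolve_left (Ne.symm hpq)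

theorem HasPathAvoidingNeighborhood.of_induce_connected {D : Set V} (hD : (G.induce D).Connected)
    {x y z : V} (hx : x ∈ D) (hy : y ∈ D) (hz : ∀ w ∈ D, ¬ G.Adj z w) :
    G.HasPathAvoidingNeighborhood x y z := by
  classical
  obtain ⟨p⟩ := hD.preconnected ⟨x, hx⟩ ⟨y, hy⟩
  refine ⟨(p.map (Embedding.induce D).toHom).bypass, Walk.bypass_isPath _, fun w hw => ?_⟩
  have := Walk.support_bypass_subset_support _ hw
  obtain ⟨w', -, rfl⟩ := List.mem_map.mp (Walk.support_map (Embedding.induce D).toHom p ▸ this)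
  exact hz _ w'.2

/-! ### Graphs without holes and asteroidal triples -/

/-- A connected noncomplete graph without holes and asteroidal triples has a simplicial vertex with
a maximum neighbor. -/
theorem exists_isMaximumNeighbor [Finite V] (hG : ¬ G.HasHole) (hAT : ¬ G.HasAsteroidalTriple)
    (hc : G.Connected) (htop : G ≠ ⊤) :
    ∃ u v, G.IsClique (G.neighborSet u) ∧ G.IsMaximumNeighbor u v := by
  obtain ⟨a, x, hxa, hax⟩ : ∃ a x, x ≠ a ∧ ¬ G.Adj a x := by
    by_contra! h
    exact htop (by ext a b; exact ⟨fun h' => h'.ne, fun h' => h a b h'.symm⟩)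
  obtain ⟨F, u₀, -, hu₀F, -, hFa, hu₀⟩ := exists_isClique_neighborSet hG hxa hax
  let T : Set (Set V) := {D | (G.induce D).Connected ∧
    ∃ u, G.IsClique (G.neighborSet u) ∧ u ∉ D ∧ ∀ d ∈ D, ¬ G.Adj u d}
  obtain ⟨D, ⟨hDc, u, hu, huD, hND⟩, hmax⟩ := (Set.toFinite T).exists_maximal
    ⟨{a}, by simp, u₀, hu₀, (hFa u₀ hu₀F).1, by
      rintro d rfl h; exact (hFa u₀ hu₀F).2 h.symm⟩
  obtain ⟨d₀, hd₀⟩ : D.Nonempty := by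
    obtain ⟨d⟩ := hDc.nonempty
    exact ⟨d, d.2⟩
  -- every simplicial vertex not adjacent to `D` is adjacent to the whole boundary of `D`
  have hK : ∀ u', G.IsClique (G.neighborSet u') → u' ∉ D → (∀ d ∈ D, ¬ G.Adj u' d) →
      ∀ k, k ∉ D → ∀ d ∈ D, G.Adj d k → G.Adj u' k := by
    intro u' hu' hu'D hND' k hk d hd hdk
    by_contra hcon
    -- Otherwise `k` could be added to the maximal set `D`.
    refine hk (hmax (y := insert k D) ⟨induce_insert_connected hDc hd hdk, u', hu', ?_, ?_⟩
      (Set.subset_insert _ _) (Or.inl rfl))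
    · rintro (rfl | h)
      · exact hND' d hd hdk.symm
      · exact hu'D h
    · rintro d' (rfl | h)
      · exact hcon
      · exact hND' d' h
  have hR : ∀ r, r ∉ D → (∀ d ∈ D, ¬ G.Adj r d) → ∀ k, k ∉ D → ∀ d ∈ D, G.Adj d k →
      G.Adj k r := by
    intro r hr hrD k hk d hd hdk
    by_contra hcon
    have hrk : r ≠ k := by rintro rfl; exact hrD d hd hdk.symm
    obtain ⟨E, u', hrE, hu'E, hEc, hEk, hu'⟩ := exists_isClique_neighborSet hG hrk hcon
    -- To leave the vertices far from `D`, `E` would have to enter the boundary of `D`; that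
    -- boundary lies in the clique `N(u)`, hence in `N[k]`, which `E` avoids. So `hK` applies to
    -- `u'`.
    have hER : ∀ y ∈ E, y ∉ D ∧ ∀ d ∈ D, ¬ G.Adj y d := by
      by_contra! hcon'
      obtain ⟨y, hy, hyR⟩ := hcon'
      obtain ⟨p, q, -, hq, hpR, hqR, hpq⟩ := exists_adj_of_induce_connected hEc hrE hy
        (A := {y | y ∉ D ∧ ∀ d ∈ D, ¬ G.Adj y d}) ⟨hr, hrD⟩ (fun h => by
          obtain ⟨d', hd', h'⟩ := hyR h.1
          exact h.2 d' hd' h')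
      have hqD : q ∉ D := fun h => hpR.2 q h hpq
      have : ∃ d' ∈ D, G.Adj q d' := by
        by_contra! h
        exact hqR ⟨hqD, h⟩
      obtain ⟨d', hd', hqd'⟩ := this
      have h1 := hK u hu huD hND k hk d hd hdk
      have h2 := hK u hu huD hND q hqD d' hd' hqd'.symm
      exact (hEk q hq).2 (hu h1 h2 (Ne.symm (hEk q hq).1))
    exact (hEk u' hu'E).2
      (hK u' hu' (hER u' hu'E).1 (hER u' hu'E).2 k hk d hd hdk).symm
  let K : Set V := {k | k ∉ D ∧ ∃ d ∈ D, G.Adj d k}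
  have hKne : K.Nonempty := by
    obtain ⟨p⟩ := hc.preconnected d₀ u
    obtain ⟨e, -, h1, h2⟩ := p.exists_boundary_dart D hd₀ huD
    exact ⟨e.snd, h2, e.fst, h1, e.adj⟩
  -- Neighborhoods in `D` of boundary vertices turn out to be nested, so a maximal one is a maximum.
  obtain ⟨v, ⟨hvD, dv, hdv, hdvv⟩, hvmax⟩ := (Set.toFinite K).exists_maximalFor
    (fun k => G.neighborSet k ∩ D) K hKne
  have hKu : ∀ k ∈ K, G.Adj u k := fun k hk => by
    obtain ⟨hkD, d, hd, hdk⟩ := hk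
    exact hK u hu huD hND k hkD d hd hdk
  have huv : G.Adj u v := hKu v ⟨hvD, dv, hdv, hdvv⟩
  have hpath : ∀ p d e, p ∈ K → d ∈ D → e ∈ D → G.Adj p d → ¬ G.Adj p e →
      ¬ G.Adj d e → G.HasPathAvoidingNeighborhood u d e := by
    intro p d e hp hd he hpd hpe hde
    refine HasPathAvoidingNeighborhood.of_induce_connected (D := insert u {p, d})
      (induce_insert_connected (G.induce_pair_connected_of_adj hpd) (Or.inl rfl)
        (hKu p hp).symm) (by simp) (by simp) ?_
    rintro w (rfl | rfl | rfl) h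
    · exact hND e he h.symm
    · exact hpe h.symm
    · exact hde h.symm
  have hnest : ∀ w ∈ K, ∀ x ∈ D, G.Adj w x → G.Adj v x := by
    intro w hw x hx hwx
    by_contra hvx
    have : ∃ y ∈ D, G.Adj v y ∧ ¬ G.Adj w y := by
      by_contra! h
      exact hvx (hvmax hw (fun y hy => ⟨h y hy.2 hy.1, hy.2⟩) ⟨hwx, hx⟩).1
    -- With private neighbors `x` of `w` and `y` of `v`, an edge `xy` would give the hole `w x y v`;
    -- without it, `u, x, y` is an asteroidal triple, with paths through `w`, `D` and `v`.
    obtain ⟨y, hy, hvy, hwy⟩ := this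
    have hwv : w ≠ v := by rintro rfl; exact hvx hwx
    have hxy : ¬ G.Adj x y := fun hxy => by
      refine hvx (adj_of_not_hasHole hG (E := {y}) (by simp) (a := w) ?_ ?_ ?_ hwx
        (hu (hKu w hw) huv hwv) rfl rfl hxy.symm hvy.symm).symm
      · rintro rfl; exact hw.1 hy
      · rintro z rfl; exact hwy
      · rintro rfl; exact hvD hx
    refine hAT ⟨u, x, y, ⟨?_, ?_, ?_⟩, ⟨hND x hx, hxy, hND y hy⟩, ?_, ?_, ?_⟩
    · rintro rfl; exact huD hx
    · rintro rfl; exact hvx hvy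
    · rintro rfl; exact huD hy
    · exact hpath w x y hw hx hy hwx hwy hxy
    · exact HasPathAvoidingNeighborhood.of_induce_connected hDc hx hy hND
    · exact hpath v y x ⟨hvD, dv, hdv, hdvv⟩ hy hx hvy hvx (fun h => hxy h.symm)
  refine ⟨u, v, hu, huv, fun w huw x hwx => ?_⟩
  by_cases hxv : x = v
  · exact Or.inl hxv
  refine Or.inr ?_
  have hwD : w ∉ D := fun h => hND w h huw
  by_cases hxD : x ∈ D
  · exact hnest w ⟨hwD, x, hxD, hwx.symm⟩ x hxD hwx
  by_cases hxK : x ∈ K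
  · exact hu huv (hKu x hxK) (Ne.symm hxv)
  · exact hR x hxD (fun d hd h => hxK ⟨hxD, d, hd, h.symm⟩) v hvD dv hdv hdvv

/-! ### Conclusion -/

/-- A minimally `t`-tough graph with `t > 1/2` is connected. -/
theorem IsMinimallyTough.connected [Finite V] {t : ℝ} (ht : 1 / 2 < t)
    (h : G.IsMinimallyTough (t : EReal)) : G.Connected := by
  have hne : Nonempty V := by
    by_contra hne
    rw [not_nonempty_iff] at hne
    exact h.ne_top (Subsingleton.elim _ _)
  refine ⟨fun x y => ?_⟩
  by_contra hxy
  have h1 : 1 < G.numComponentsDelete ∅ :=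
    one_lt_numComponentsDelete (A := {z | G.Reachable x z}) (x := x) (y := y) (Reachable.refl x)
      hxy (by simp) (by simp) fun a b ha hb hab =>
        absurd (Reachable.trans ha hab.reachable) hb
  have h2 := h.isTough _ h1
  have h3 : (1 : ℝ) < G.numComponentsDelete ∅ := by exact_mod_cast h1
  rw [Set.ncard_empty] at h2
  push_cast at h2
  nlinarith

theorem IsMinimallyTough.not_isIntervalGraph [Finite V] {t : ℝ} (ht : 1 / 2 < t)
    (h : G.IsMinimallyTough (t : EReal)) : ¬ G.IsIntervalGraph := by
  intro hI
  have hc := h.connected ht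
  have := hc.nonempty
  have : Nontrivial V := by
    by_contra hV
    rw [not_nontrivial_iff_subsingleton] at hV
    exact h.ne_top (Subsingleton.elim _ _)
  obtain ⟨u, v, hu, hv⟩ := hI.exists_isMaximumNeighbor
    fun u => hc.preconnected.exists_adj_of_nontrivial u
  exact hv.not_isMinimallyTough ht hu h

theorem IsMinimallyTough.hasHole_or_hasAsteroidalTriple [Finite V] {t : ℝ} (ht : 1 / 2 < t)
    (h : G.IsMinimallyTough (t : EReal)) : G.HasHole ∨ G.HasAsteroidalTriple := by
  by_contra! hcon
  obtain ⟨u, v, hu, hv⟩ := exists_isMaximumNeighbor hcon.1 hcon.2 (h.connected ht) h.ne_top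
  exact hv.not_isMinimallyTough ht hu h

end SimpleGraph

theorem mainTheorem9 {V : Type*} [Finite V] (G : SimpleGraph V) :
    (∀ t : ℚ, (1 / 2 : ℚ) < t →
      ¬ (G.IsIntervalGraph ∧ G.IsMinimallyTough ((t : ℝ) : EReal))) ∧
    (∀ t : ℚ, (1 : ℚ) < t →
      G.IsMinimallyTough ((t : ℝ) : EReal) → G.HasHole ∨ G.HasAsteroidalTriple) := by
  refine ⟨fun t ht h => ?_, fun t ht h => ?_⟩
  · have ht' : (1 / 2 : ℝ) < t := by
      have : ((1 / 2 : ℚ) : ℝ) < t := by exact_mod_cast ht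
      simpa using this
    exact h.2.not_isIntervalGraph ht' h.1
  · have ht' : (1 : ℝ) < t := by exact_mod_cast ht
    exact h.hasHole_or_hasAsteroidalTriple (by linarith)
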